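/- \textbf{Conventions.} Let $\Omega\subseteq\mathbb R^3$ be a nonempty open set. For $p>1$, $\mathcal F^p_{\mathbb Z}(\Omega)$ is the class of $L^p$-integrable $2$-forms $F$ on $\Omega$ such that, for all $x\in\Omega$ and almost all $r>0$ with $B(x,r)\subseteq\Omega$, $\int_{\partial B(x,r)}i^*F\in\mathbb Z$, where $i$ is the inclusion of $\partial B(x,r)$ into $\mathbb R^3$. An integer rectifiable $1$-current $J=(M,\theta,\tau)$ acts by $J(\omega)=\int_M\theta\,\langle\omega,\tau\rangle\,d\mathcal H^1$, where $M$ is countably $1$-rectifiable, $\theta$ is integer valued and nonzero on $M$ and locally $\mathcal H^1$-integrable on $M$, and $\tau$ is a unit field spanning the approximate tangent line of $M$ at $\mathcal H^1$-a.e. point; its mass is $\mathbb M(J)=\int_M|\theta|\,d\mathcal H^1$ and its boundary is $\langle\phi,\partial J\rangle=J(d\phi)$. If $J$ is compactly supported and $u=d(\cdot,x)$, the slice $\langle J,d(\cdot,x),r\rangle$ is said to exist if $\langle J,d(\cdot,x),r\rangle(\psi):=\lim_{\rho\to0^+}\frac1{2\rho}J\big(\psi\,\mathbf 1_{\{|u-r|\le\rho\}}\,du\big)$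 exists for every smooth $\psi$ on $\mathbb R^3$. \textbf{Lemma.} For every nonempty open $\Omega\subseteq\mathbb R^3$ there is an integer rectifiable $1$-current $J$ of finite mass, with compact support in $\Omega$, such that \begin{itemize} \item for every $x\in\mathbb R^3$ and all but at most countably many $r>0$, the slice $\langle J,d(\cdot,x),r\rangle$ exists and $\langle J,d(\cdot,x),r\rangle(1)\in\mathbb Z$; \item for no $p>1$ (including $p=\infty$) and no $F\in\mathcal F^p_{\mathbb Z}(\Omega)$ does $$\langle\phi,\partial J\rangle=\int_\Omega d\phi\wedge F\qquad\text{for all }\phi\in C^\infty_c(\Omega)$$ hold. In particular, $J$ is not a rectifiable current $I$ associated to some such $F$ by the requirements that $\langle\phi,\partial I\rangle=\int_\Omega d\phi\wedge F$ for all $\phi\in C_c^\infty(\Omega)$ and $\mathbb M(I)\le C\|F\|_{L^1}$ with $C$ independent of $F$. \end{itemize} -/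

import Mathlib

open MeasureTheory Set Filter Topology
open scoped ContDiff ENNReal NNReal

noncomputable section

namespace IntegerFlux

/-- Euclidean three-space. -/
abbrev E3 : Type := EuclideanSpace ℝ (Fin 3)

/-- The covectors of Euclidean three-space. -/
abbrev Covector : Type := E3 →L[ℝ] ℝ

/-- The alternating bilinear forms on Euclidean three-space. -/
abbrev TwoCovector : Type := E3 [⋀^Fin 2]→L[ℝ] ℝ

/-- The standard basis vectors. -/
abbrev e (i : Fin 3) : E3 := EuclideanSpace.single i (1 : ℝ)

/-! ### Integer multiplicity rectifiable 1-currents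

In Mathlib's normalization `μH[1]` is the usual one-dimensional Hausdorff measure (it agrees
with length on segments). -/

/-- `M` is countably 1-rectifiable: up to an `ℋ¹`-null set it is covered by countably many
Lipschitz curves. -/
def IsCountablyRectifiable (M : Set E3) : Prop :=
  ∃ γ : ℕ → ℝ → E3, (∀ n, ∃ K : ℝ≥0, LipschitzWith K (γ n)) ∧
    μH[1] (M \ ⋃ n, range (γ n)) = 0

/-- The line `ℝ τ` is an approximate tangent line of `M` at `x`: for every aperture `ε > 0`, the
part of `M` in `B(x, r)` outside the double cone around `x + ℝ τ` has `ℋ¹`-measure `o(r)`.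
For a countably 1-rectifiable `M` of locally finite `ℋ¹`-measure there is exactly one such line
at `ℋ¹`-almost every point of `M`, namely the approximate tangent space. -/
def IsApproxTangent (M : Set E3) (x τ : E3) : Prop :=
  ∀ ε : ℝ, 0 < ε →
    Tendsto (fun r : ℝ =>
        μH[1] (M ∩ Metric.ball x r ∩
          {y | ε * ‖y - x‖ < Metric.infDist (y - x) (Submodule.span ℝ {τ} : Set E3)})
          / ENNReal.ofReal r)
      (𝓝[>] 0) (𝓝 0)

/-- An integer multiplicity rectifiable 1-current `(M, θ, τ)` in three-space, acting on 1-forms by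
`η ↦ ∫_M θ ⟨η, τ⟩ dℋ¹`. -/
structure RectifiableCurrent where
  /-- the set `M` that carries the current -/
  carrier : Set E3
  /-- the integer multiplicity `θ` -/
  mult : E3 → ℤ
  /-- the orienting unit tangent field `τ` -/
  orient : E3 → E3
  measurableSet_carrier : MeasurableSet carrier
  measurable_mult : Measurable mult
  measurable_orient : Measurable orient
  rectifiable : IsCountablyRectifiable carrier
  mult_ne_zero : ∀ x ∈ carrier, mult x ≠ 0
  locally_finite : ∀ K : Set E3, IsCompact K →
    ∫⁻ x in carrier ∩ K, (‖mult x‖₊ : ℝ≥0∞) ∂μH[1] < ⊤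
  norm_orient : ∀ᵐ x ∂(μH[1] : Measure E3), x ∈ carrier → ‖orient x‖ = 1
  tangent : ∀ᵐ x ∂(μH[1] : Measure E3), x ∈ carrier → IsApproxTangent carrier x (orient x)

/-- The value `J(η) = ∫_M θ ⟨η, τ⟩ dℋ¹` of the current on a 1-form. -/
def RectifiableCurrent.eval (J : RectifiableCurrent) (η : E3 → Covector) : ℝ :=
  ∫ x in J.carrier, (J.mult x : ℝ) * η x (J.orient x) ∂μH[1]

/-- The mass `𝐌(J) = ∫_M |θ| dℋ¹`. -/
def RectifiableCurrent.mass (J : RectifiableCurrent) : ℝ≥0∞ :=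
  ∫⁻ x in J.carrier, (‖J.mult x‖₊ : ℝ≥0∞) ∂μH[1]

/-- `J` is supported in a compact subset of `Ω`. -/
def RectifiableCurrent.CompactlySupportedIn (J : RectifiableCurrent) (Ω : Set E3) : Prop :=
  ∃ K : Set E3, IsCompact K ∧ K ⊆ Ω ∧ J.carrier ⊆ K

/-- The boundary `∂J` as a distribution: `⟨φ, ∂J⟩ = J(dφ)`. -/
def RectifiableCurrent.boundary (J : RectifiableCurrent) (φ : E3 → ℝ) : ℝ :=
  J.eval (fun x => fderiv ℝ φ x)

/-- The 0-current `S` is the slice `⟨J, dist(·, x), r⟩` of the compactly supported current `J`: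
with `u = dist(·, x)`, for every smooth function `ψ`,
`S(ψ) = lim_{ρ → 0+} (2ρ)⁻¹ J(ψ 𝟙_{|u - r| ≤ ρ} du)`.
As a pointwise limit of distributions, such an `S` is linear and continuous on smooth
functions. -/
def RectifiableCurrent.HasSphereSlice (J : RectifiableCurrent) (x : E3) (r : ℝ)
    (S : (E3 → ℝ) → ℝ) : Prop :=
  ∀ ψ : E3 → ℝ, ContDiff ℝ ∞ ψ →
    Tendsto (fun ρ : ℝ => (2 * ρ)⁻¹ *
        J.eval ({y : E3 | |dist y x - r| ≤ ρ}.indicator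
          (fun y => ψ y • fderiv ℝ (fun z : E3 => dist z x) y)))
      (𝓝[>] 0) (𝓝 (S ψ))

/-! ### 2-forms with integer fluxes -/

/-- The vector `X` that corresponds to an alternating 2-form `F` by `F(U, V) = X · (U × V)`. -/
def vectorOf (F : TwoCovector) : E3 :=
  !₂[F ![e 1, e 2], F ![e 2, e 0], F ![e 0, e 1]]

/-- The density of `i^*F` with respect to the area of the unit sphere, where `i` is the map
`σ ↦ x + r σ` onto the sphere of centre `x` and radius `r`, oriented by the outer normal `σ`:
`i^*F = r² (X · σ) dσ`. -/
def pullbackDensity (F : E3 → TwoCovector) (x : E3) (r : ℝ)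
    (σ : Metric.sphere (0 : E3) 1) : ℝ :=
  r ^ 2 * inner ℝ (vectorOf (F (x + r • (σ : E3)))) (σ : E3)

/-- `F` is in the class `ℱ_ℤ^p(Ω)`: it is an `L^p` 2-form on `Ω`, and for all `x ∈ Ω` and almost
all `r > 0` with `B(x, r) ⊆ Ω` the integral `∫_{∂B(x, r)} i^*F` is an integer.
The measure `volume.toSphere` is the surface area of the unit sphere. -/
def IntegerFluxClass (p : ℝ≥0∞) (Ω : Set E3) (F : E3 → TwoCovector) : Prop :=
  MemLp F p (volume.restrict Ω) ∧
    ∀ x ∈ Ω, ∀ᵐ r : ℝ, 0 < r → Metric.ball x r ⊆ Ω →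
      Integrable (pullbackDensity F x r) (volume : Measure E3).toSphere ∧
        ∃ k : ℤ, ∫ σ, pullbackDensity F x r σ ∂(volume : Measure E3).toSphere = k

/-- The coefficient of the 3-form `α ∧ F` with respect to the volume form. -/
def wedgeCoeff (α : Covector) (F : TwoCovector) : ℝ :=
  α (e 0) * F ![e 1, e 2] - α (e 1) * F ![e 0, e 2] + α (e 2) * F ![e 0, e 1]

/-- `∂J = dF` in the sense of distributions on `Ω`:
`⟨φ, ∂J⟩ = ∫_Ω dφ ∧ F` for every `φ ∈ C_c^∞(Ω)`. -/
def BoundaryEq (Ω : Set E3) (J : RectifiableCurrent) (F : E3 → TwoCovector) : Prop :=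
  ∀ φ : E3 → ℝ, ContDiff ℝ ∞ φ → HasCompactSupport φ → tsupport φ ⊆ Ω →
    J.boundary φ = ∫ x in Ω, wedgeCoeff (fderiv ℝ φ x) (F x)

end IntegerFlux

end

/-!
# A rectifiable current with integral slices that is not the boundary datum of an `L^p` form

Choose a segment `{c + t e₀ | 0 < t < δ}` whose closed `δ`-ball lies in `Ω`, and let `J` be this
segment with multiplicity `⌈g t⌉`, where `g t = 1 / (t log² t)`. The function `g` is integrable
near `0`, with antiderivative `-1 / log t`, so that `J` has finite mass; but `t g t = 1 / log² t`
is not `O(t ^ α)` for any `α > 0`.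

*Slices.* Along the line, the distance to `x` is `u t = √((t - a)² + h)`. If `r ≠ √h`, then the
sphere of radius `r` either misses the line or crosses it transversally at two points. Since the
multiplicity is monotone on the segment, it is continuous at both points for all but countably many
`r`. Writing the average over the shell `|u - r| ≤ ρ` as a symmetric difference quotient of
primitives (`tendsto_shell_average`), the slice is the difference of the point masses at the two
crossings, weighted by the multiplicities there; see `segmentCurrent_hasSphereSlice`.

*Nonexistence of `F`.* Test `∂J` with a radially decreasing bump `φ` of height `1` on the ball of
centre `c` and radius `ε`. The multiplicity is at least `g ε` on `(0, ε)`, so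
`-⟨φ, ∂J⟩ ≥ g ε` (`logDensity_le_neg_boundary`). On the other hand `|dφ| ≤ C / ε`, and by Hölder's
inequality the `L¹` norm of an `L^p` form on that ball is `O(ε ^ (3 - 3 / p))`
(`exists_integral_closedBall_norm_le`). An equation `∂J = dF` would thus give
`ε g ε ≤ C ε ^ (3 - 3 / p)` for all small `ε`, which is false for `p > 1`.
-/

namespace IntegerFlux

/-! ### The density `1 / (t log² t)` -/

/-- The function `1 / (t log² t)`: integrable near `0`, but larger there than `t ^ (α - 1)` for
every `α > 0`. -/
noncomputable def logDensity (t : ℝ) : ℝ := (t * Real.log t ^ 2)⁻¹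

lemma logDensity_pos {t : ℝ} (h0 : 0 < t) (h1 : t < 1) : 0 < logDensity t := by
  have : 0 < Real.log t ^ 2 := sq_pos_iff.2 (Real.log_neg h0 h1).ne
  unfold logDensity
  positivity

lemma measurable_logDensity : Measurable logDensity := by
  unfold logDensity
  fun_prop

lemma antitoneOn_logDensity : AntitoneOn logDensity (Ioo 0 (Real.exp (-2))) := by
  have hmono : MonotoneOn (fun t : ℝ => t * Real.log t ^ 2) (Ioo 0 (Real.exp (-2))) := by
    have hd : ∀ t ∈ Ioo 0 (Real.exp (-2)),
        HasDerivAt (fun t : ℝ => t * Real.log t ^ 2) (Real.log t * (Real.log t + 2)) t := by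
      intro t ht
      have := (hasDerivAt_id t).mul ((Real.hasDerivAt_log ht.1.ne').pow 2)
      convert! this using 1
      have := ht.1.ne'
      simp
      field_simp
    refine monotoneOn_of_deriv_nonneg (convex_Ioo _ _)
      (fun t ht => (hd t ht).continuousAt.continuousWithinAt)
      (fun t ht => ?_) (fun t ht => ?_)
    · rw [interior_Ioo] at ht
      exact (hd t ht).differentiableAt.differentiableWithinAt
    · rw [interior_Ioo] at ht
      rw [(hd t ht).deriv]
      have : Real.log t ≤ -2 := by
        rw [Real.log_le_iff_le_exp ht.1]; exact ht.2.le
      nlinarith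
  intro a ha b hb hab
  unfold logDensity
  have h1 : Real.log a < 0 := Real.log_neg ha.1 (ha.2.trans (by simp))
  have : 0 < Real.log a ^ 2 := sq_pos_iff.2 h1.ne
  exact inv_anti₀ (mul_pos ha.1 this) (hmono ha hb hab)

lemma integrableOn_logDensity {δ : ℝ} (hδ : δ ≤ Real.exp (-2)) :
    IntegrableOn logDensity (Ioc 0 δ) := by
  have hlt : δ < 1 := hδ.trans_lt (by simp)
  have hneg : ∀ t ∈ Ioo 0 δ, Real.log t ≠ 0 := fun t ht =>
    (Real.log_neg ht.1 (ht.2.trans hlt)).ne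
  -- an antiderivative of the density is `-1 / log t`, continuous up to `0` since `1 / log 0 = 0`
  refine intervalIntegral.integrableOn_deriv_of_nonneg (g := fun t => -(Real.log t)⁻¹) ?_ ?_ ?_
  · intro t ht
    apply ContinuousAt.continuousWithinAt
    rcases ht.1.eq_or_lt with rfl | h
    · rw [continuousAt_iff_punctured_nhds]
      have := (tendsto_inv_atBot_zero.comp Real.tendsto_log_nhdsNE_zero).neg
      simpa using! this
    · have : Real.log t ≠ 0 := (Real.log_neg h (ht.2.trans_lt hlt)).ne
      exact ((Real.continuousAt_log h.ne').inv₀ this).neg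
  · intro t ht
    have := ((Real.hasDerivAt_log ht.1.ne').inv (hneg t ht)).neg
    convert! this using 1
    have := ht.1.ne'
    have := hneg t ht
    unfold logDensity
    field_simp
  · intro t ht
    exact (logDensity_pos ht.1 (ht.2.trans hlt)).le

/-- `t * logDensity t = 1 / log² t` decays more slowly at `0` than any power of `t`. -/
lemma not_logDensity_le_rpow {δ C α : ℝ} (hδ : 0 < δ) (hα : 0 < α) :
    ¬ ∀ t ∈ Ioo 0 δ, t * logDensity t ≤ C * t ^ α := by
  intro h
  have h1 : Tendsto (fun t : ℝ => C * (Real.log t * t ^ (α / 2)) ^ 2) (𝓝[>] 0) (𝓝 (C * 0 ^ 2)) :=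
    ((tendsto_log_mul_rpow_nhdsGT_zero (half_pos hα)).pow 2).const_mul C
  have h2 : ∀ᶠ t : ℝ in 𝓝[>] 0, C * (Real.log t * t ^ (α / 2)) ^ 2 < 1 :=
    h1.eventually_lt_const (by norm_num)
  have h3 : Ioo 0 (min δ 1) ∈ 𝓝[>] (0 : ℝ) := Ioo_mem_nhdsGT (by positivity)
  obtain ⟨t, h2, h3⟩ := (h2.and h3).exists
  have h4 := h t ⟨h3.1, h3.2.trans_le (min_le_left _ _)⟩
  have hl := Real.log_neg h3.1 (h3.2.trans_le (min_le_right _ _))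
  have hl2 : 0 < Real.log t ^ 2 := sq_pos_iff.2 hl.ne
  have h5 : t * logDensity t = (Real.log t ^ 2)⁻¹ := by
    have := h3.1.ne'
    unfold logDensity
    field_simp
  have h6 : (t ^ (α / 2)) ^ 2 = t ^ α := by
    rw [← Real.rpow_natCast, ← Real.rpow_mul h3.1.le]; norm_num
  rw [h5, inv_le_iff_one_le_mul₀ hl2] at h4
  rw [mul_pow, h6] at h2
  nlinarith

/-! ### Rectifiable currents carried by a segment -/

/-- The unit speed line through `c` in the direction of the first coordinate axis. -/
noncomputable def axisLine (c : E3) (t : ℝ) : E3 := c + t • e 0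

lemma norm_e (i : Fin 3) : ‖e i‖ = 1 := by simp [e]

lemma isometry_axisLine (c : E3) : Isometry (axisLine c) := by
  refine Isometry.of_dist_eq fun s t => ?_
  simp [axisLine, dist_eq_norm, ← sub_smul, norm_smul]

lemma dist_axisLine (c : E3) (t : ℝ) : dist (axisLine c t) c = |t| := by
  simp [axisLine, norm_smul]

lemma axisLine_apply_zero (c : E3) (t : ℝ) : axisLine c t 0 - c 0 = t := by
  simp [axisLine]

lemma hasDerivAt_axisLine (c : E3) (t : ℝ) : HasDerivAt (axisLine c) (e 0) t := by
  have h := ((hasDerivAt_id t).smul_const (e 0)).const_add c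
  rw [one_smul] at h
  exact h

lemma measurableEmbedding_axisLine (c : E3) : MeasurableEmbedding (axisLine c) :=
  (isometry_axisLine c).isClosedEmbedding.measurableEmbedding

lemma hausdorffMeasure_restrict_image_axisLine (c : E3) (s : Set ℝ) (hs : MeasurableSet s) :
    (μH[1] : Measure E3).restrict (axisLine c '' s) =
      (volume.restrict s).map (axisLine c) := by
  have h := (isometry_axisLine c).map_hausdorffMeasure (d := 1) (Or.inl zero_le_one)
  rw [hausdorffMeasure_real] at h
  have hm := (measurableEmbedding_axisLine c).measurableSet_image.2 hs
  have h2 : (volume.restrict s).map (axisLine c) =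
      (volume.map (axisLine c)).restrict (axisLine c '' s) := by
    rw [(measurableEmbedding_axisLine c).restrict_map,
      (isometry_axisLine c).injective.preimage_image]
  rw [h2, h, Measure.restrict_restrict hm, inter_eq_left.2 (image_subset_range _ _)]

/-- The multiplicity `⌈1 / (t log² t)⌉` of the segment current at parameter `t`, as a real
number. -/
noncomputable def ceilDensity (t : ℝ) : ℝ := (⌈logDensity t⌉ : ℤ)

lemma measurable_ceilDensity : Measurable ceilDensity :=
  (measurable_of_countable (fun n : ℤ => (n : ℝ))).comp
    (Int.measurable_ceil.comp measurable_logDensity)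

lemma ceilDensity_nonneg {t : ℝ} (h0 : 0 < t) (h1 : t < 1) : 0 ≤ ceilDensity t :=
  (logDensity_pos h0 h1).le.trans (Int.le_ceil _)

lemma antitoneOn_ceilDensity : AntitoneOn ceilDensity (Ioo 0 (Real.exp (-2))) :=
  fun _ ha _ hb hab => Int.cast_le.2 (Int.ceil_mono (antitoneOn_logDensity ha hb hab))

lemma integrableOn_ceilDensity {δ : ℝ} (hδ : δ ≤ Real.exp (-2)) :
    IntegrableOn ceilDensity (Ioo 0 δ) := by
  have h : IntegrableOn (fun t => logDensity t + 1) (Ioo 0 δ) :=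
    ((integrableOn_logDensity hδ).mono_set Ioo_subset_Ioc_self).add
      (integrableOn_const (by simp))
  refine h.mono' measurable_ceilDensity.aestronglyMeasurable ?_
  filter_upwards [ae_restrict_mem measurableSet_Ioo] with t ht
  rw [Real.norm_of_nonneg (ceilDensity_nonneg ht.1 (ht.2.trans_le (hδ.trans (by simp))))]
  exact (Int.ceil_lt_add_one _).le

lemma lintegral_nnnorm_ceil_logDensity_lt_top (c : E3) {δ : ℝ} (hδ : δ ≤ Real.exp (-2)) :
    ∫⁻ x in axisLine c '' Ioo 0 δ, (‖⌈logDensity (x 0 - c 0)⌉‖₊ : ℝ≥0∞) ∂μH[1] < ⊤ := by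
  rw [hausdorffMeasure_restrict_image_axisLine c _ measurableSet_Ioo,
    (measurableEmbedding_axisLine c).lintegral_map]
  simp only [axisLine_apply_zero]
  convert! (integrableOn_ceilDensity hδ).2 using 3 with t

/-- The current carried by the open segment `{c + t e₀ | 0 < t < δ}`, oriented by `e₀`, with
multiplicity `⌈1 / (t log² t)⌉`. -/
noncomputable def segmentCurrent (c : E3) (δ : ℝ) (hδ : δ ≤ Real.exp (-2)) :
    RectifiableCurrent where
  carrier := axisLine c '' Ioo 0 δ
  mult y := ⌈logDensity (y 0 - c 0)⌉
  orient _ := e 0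
  measurableSet_carrier := (measurableEmbedding_axisLine c).measurableSet_image.2 measurableSet_Ioo
  measurable_mult := Int.measurable_ceil.comp (measurable_logDensity.comp (by fun_prop))
  measurable_orient := measurable_const
  rectifiable := by
    refine ⟨fun _ => axisLine c, fun _ => ⟨1, (isometry_axisLine c).lipschitz⟩, ?_⟩
    rw [sdiff_eq_empty.2, measure_empty]
    exact (image_subset_range _ _).trans (subset_iUnion (fun _ : ℕ => range (axisLine c)) 0)
  mult_ne_zero := by
    rintro _ ⟨t, ht, rfl⟩
    rw [axisLine_apply_zero]
    exact (Int.ceil_pos.2 (logDensity_pos ht.1 (ht.2.trans_le (hδ.trans (by simp))))).ne'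
  locally_finite := by
    intro K _
    refine (lintegral_mono_set inter_subset_left).trans_lt ?_
    exact lintegral_nnnorm_ceil_logDensity_lt_top c hδ
  norm_orient := Eventually.of_forall fun _ _ => norm_e 0
  tangent := by
    refine Eventually.of_forall ?_
    rintro _ ⟨t, ht, rfl⟩ ε hε
    -- the carrier lies in the tangent line, so that no part of it is outside the cone
    have h : ∀ r, axisLine c '' Ioo 0 δ ∩ Metric.ball (axisLine c t) r ∩
        {y | ε * ‖y - axisLine c t‖ <
          Metric.infDist (y - axisLine c t) (Submodule.span ℝ {e 0} : Set E3)} = ∅ := by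
      intro r
      refine eq_empty_of_forall_notMem ?_
      rintro _ ⟨⟨⟨s, hs, rfl⟩, -⟩, h⟩
      have hmem : axisLine c s - axisLine c t ∈ (Submodule.span ℝ {e 0} : Set E3) := by
        have : axisLine c s - axisLine c t = (s - t) • e 0 := by
          simp [axisLine, sub_smul]
        rw [this]
        exact Submodule.smul_mem _ _ (Submodule.mem_span_singleton_self _)
      rw [mem_ofPred_eq, Metric.infDist_zero_of_mem hmem] at h
      exact absurd h (not_lt.2 (by positivity))
    simp [h]

lemma segmentCurrent_eval (c : E3) {δ : ℝ} (hδ : δ ≤ Real.exp (-2)) (η : E3 → Covector) :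
    (segmentCurrent c δ hδ).eval η = ∫ t in Ioo 0 δ, ceilDensity t * η (axisLine c t) (e 0) := by
  unfold RectifiableCurrent.eval segmentCurrent
  dsimp only
  rw [hausdorffMeasure_restrict_image_axisLine c _ measurableSet_Ioo,
    (measurableEmbedding_axisLine c).integral_map]
  simp only [axisLine_apply_zero, ceilDensity]

lemma segmentCurrent_mass_lt_top (c : E3) {δ : ℝ} (hδ : δ ≤ Real.exp (-2)) :
    (segmentCurrent c δ hδ).mass < ⊤ :=
  lintegral_nnnorm_ceil_logDensity_lt_top c hδ

lemma segmentCurrent_compactlySupportedIn {c : E3} {δ : ℝ} (hδ : δ ≤ Real.exp (-2)) {Ω : Set E3}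
    (hsub : Metric.closedBall c δ ⊆ Ω) : (segmentCurrent c δ hδ).CompactlySupportedIn Ω := by
  refine ⟨_, isCompact_closedBall c δ, hsub, ?_⟩
  rintro _ ⟨t, ht, rfl⟩
  rw [Metric.mem_closedBall, dist_axisLine, abs_of_pos ht.1]
  exact ht.2.le

/-! ### Averages over thin spherical shells along a line -/

/-- A differentiable function has its derivative as limit of symmetric difference quotients. -/
lemma tendsto_symmetric_of_hasDerivAt {G : ℝ → ℝ} {G' r : ℝ} (h : HasDerivAt G G' r) :
    Tendsto (fun ρ : ℝ => (2 * ρ)⁻¹ * (G (r + ρ) - G (r - ρ))) (𝓝[>] 0) (𝓝 G') := by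
  have h1 : HasDerivAt (fun ρ => G (r + ρ) - G (r - ρ)) (G' - -G') 0 :=
    (HasDerivAt.comp_const_add r 0 (by simpa using h)).sub
      (HasDerivAt.comp_const_sub r 0 (by simpa using h))
  have h2 := ((hasDerivAt_iff_tendsto_slope_zero.1 h1).mono_left
    (nhdsGT_le_nhdsNE 0)).const_mul (2⁻¹ : ℝ)
  convert! h2 using 2
  · simp [mul_comm, mul_assoc]
  · ring

lemma hasDerivAt_sqrt_sq_sub {h r : ℝ} (hr : h < r ^ 2) :
    HasDerivAt (fun v : ℝ => √(v ^ 2 - h)) (r / √(r ^ 2 - h)) r := by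
  have h1 : HasDerivAt (fun v : ℝ => v ^ 2 - h) (2 * r) r := by
    simpa using ((hasDerivAt_id r).pow 2).sub_const h
  convert! h1.sqrt (sub_pos.2 hr).ne' using 1
  rw [mul_div_mul_left _ _ two_ne_zero]

lemma setOf_abs_sqrt_sub_le {a h r ρ : ℝ} (hρ : 0 < ρ) (hrρ : 0 < r - ρ)
    (hlt : h < (r - ρ) ^ 2) :
    {t : ℝ | |√((t - a) ^ 2 + h) - r| ≤ ρ} =
      Icc (a + √((r - ρ) ^ 2 - h)) (a + √((r + ρ) ^ 2 - h)) ∪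
      Icc (a - √((r + ρ) ^ 2 - h)) (a - √((r - ρ) ^ 2 - h)) := by
  ext t
  have hs : 0 ≤ √((r - ρ) ^ 2 - h) := Real.sqrt_nonneg _
  have h1 : |√((t - a) ^ 2 + h) - r| ≤ ρ ↔
      √((r - ρ) ^ 2 - h) ≤ |t - a| ∧ |t - a| ≤ √((r + ρ) ^ 2 - h) := by
    have e1 : √((t - a) ^ 2 + h) ≤ r + ρ ↔ _ := Real.sqrt_le_left (by linarith)
    have e2 : r - ρ ≤ √((t - a) ^ 2 + h) ↔ _ := Real.le_sqrt' hrρ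
    rw [abs_sub_le_iff, sub_le_iff_le_add', sub_le_comm, and_comm, e1, e2,
      Real.sqrt_le_left (abs_nonneg _), Real.le_sqrt (abs_nonneg _), sq_abs,
      sub_le_iff_le_add, le_sub_iff_add_le]
    nlinarith
  change |√((t - a) ^ 2 + h) - r| ≤ ρ ↔ _
  rw [h1]
  simp only [mem_union, mem_Icc, le_abs, abs_le]
  constructor
  · rintro ⟨ht | ht, ht'⟩
    · left; constructor <;> linarith
    · right; constructor <;> linarith
  · rintro (ht | ht)
    · exact ⟨Or.inl (by linarith), by linarith, by linarith⟩
    · exact ⟨Or.inr (by linarith), by linarith, by linarith⟩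

/-- The average of `f` over the shell where `√((t - a)² + h)` is close to `r` is given by the
two points of the level set, weighted with the derivative of its inverse branches. -/
lemma tendsto_shell_average {f : ℝ → ℝ} (hf : Integrable f) {a h r : ℝ} (hr0 : 0 < r)
    (hr : h < r ^ 2) (h1 : ContinuousAt f (a + √(r ^ 2 - h)))
    (h2 : ContinuousAt f (a - √(r ^ 2 - h))) :
    Tendsto (fun ρ : ℝ => (2 * ρ)⁻¹ * ∫ t in {t : ℝ | |√((t - a) ^ 2 + h) - r| ≤ ρ}, f t)
      (𝓝[>] 0)
      (𝓝 (f (a + √(r ^ 2 - h)) * (r / √(r ^ 2 - h)) +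
        f (a - √(r ^ 2 - h)) * (r / √(r ^ 2 - h)))) := by
  set s : ℝ → ℝ := fun v => √(v ^ 2 - h) with hs
  have hsd : HasDerivAt s (r / s r) r := hasDerivAt_sqrt_sq_sub hr
  have hii : ∀ x y, IntervalIntegrable f volume x y := fun x y => hf.intervalIntegrable
  have hmeas : ∀ x, StronglyMeasurableAtFilter f (𝓝 x) volume := fun x =>
    hf.1.stronglyMeasurableAtFilter
  have hG1 : HasDerivAt (fun v => ∫ t in (0 : ℝ)..(a + s v), f t) (f (a + s r) * (r / s r)) r :=
    HasDerivAt.comp (h₂ := fun u => ∫ t in (0 : ℝ)..u, f t) r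
      (intervalIntegral.integral_hasDerivAt_right (hii 0 _) (hmeas _) h1) (hsd.const_add a)
  have hG2 : HasDerivAt (fun v => ∫ t in (0 : ℝ)..(a - s v), f t) (f (a - s r) * -(r / s r)) r :=
    HasDerivAt.comp (h₂ := fun u => ∫ t in (0 : ℝ)..u, f t) r
      (intervalIntegral.integral_hasDerivAt_right (hii 0 _) (hmeas _) h2) (hsd.const_sub a)
  have hlim := (tendsto_symmetric_of_hasDerivAt hG1).sub (tendsto_symmetric_of_hasDerivAt hG2)
  have hval : f (a + s r) * (r / s r) - f (a - s r) * -(r / s r) =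
    f (a + s r) * (r / s r) + f (a - s r) * (r / s r) := by ring
  rw [hval] at hlim
  refine hlim.congr' ?_
  have hev1 : ∀ᶠ ρ : ℝ in 𝓝[>] 0, 0 < r - ρ := by
    refine nhdsWithin_le_nhds (Tendsto.eventually_const_lt (u := 0) (v := r - 0) (by simpa) ?_)
    exact (continuous_const.sub continuous_id).tendsto 0
  have hev2 : ∀ᶠ ρ : ℝ in 𝓝[>] 0, h < (r - ρ) ^ 2 := by
    refine nhdsWithin_le_nhds (Tendsto.eventually_const_lt (v := (r - 0) ^ 2) (by simpa) ?_)
    exact ((continuous_const.sub continuous_id).pow 2).tendsto 0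
  filter_upwards [hev1, hev2, self_mem_nhdsWithin] with ρ hρ1 hρ2 hρ
  rw [mem_Ioi] at hρ
  have hle : s (r - ρ) ≤ s (r + ρ) := Real.sqrt_le_sqrt (by nlinarith)
  have hpos : 0 < s (r - ρ) := Real.sqrt_pos.2 (sub_pos.2 hρ2)
  have e1 := intervalIntegral.integral_interval_sub_left
    (hii 0 (a + s (r + ρ))) (hii 0 (a + s (r - ρ)))
  have e2 := intervalIntegral.integral_interval_sub_left
    (hii 0 (a - s (r - ρ))) (hii 0 (a - s (r + ρ)))
  rw [setOf_abs_sqrt_sub_le hρ hρ1 hρ2, setIntegral_union ?_ measurableSet_Icc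
    hf.integrableOn hf.integrableOn, integral_Icc_eq_integral_Ioc, integral_Icc_eq_integral_Ioc,
    ← intervalIntegral.integral_of_le (by linarith), ← intervalIntegral.integral_of_le
      (by linarith), ← e1, ← e2]
  · ring
  · rw [Set.disjoint_left]
    rintro t ⟨ht1, _⟩ ⟨_, ht2⟩
    simp only [hs] at hpos
    linarith

/-! ### Slices of the segment current -/

/-- Squared distance of `x` to the line through `c` along the first axis. -/
noncomputable def distSqToAxis (c x : E3) : ℝ := (c 1 - x 1) ^ 2 + (c 2 - x 2) ^ 2

lemma distSqToAxis_nonneg (c x : E3) : 0 ≤ distSqToAxis c x := by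
  unfold distSqToAxis; positivity

lemma dist_axisLine_eq_sqrt (c x : E3) (t : ℝ) :
    dist (axisLine c t) x = √((t - (x 0 - c 0)) ^ 2 + distSqToAxis c x) := by
  rw [EuclideanSpace.dist_eq, Fin.sum_univ_three]
  congr 1
  simp [axisLine, distSqToAxis, Real.dist_eq, sq_abs]
  ring

lemma fderiv_dist_axisLine (c x : E3) {t : ℝ} (ht : dist (axisLine c t) x ≠ 0) :
    fderiv ℝ (fun z : E3 => dist z x) (axisLine c t) (e 0) =
      (t - (x 0 - c 0)) / dist (axisLine c t) x := by
  have hd : DifferentiableAt ℝ (fun z : E3 => dist z x) (axisLine c t) :=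
    differentiableAt_id.dist ℝ (differentiableAt_const x) (dist_ne_zero.1 ht)
  have h1 := hd.hasFDerivAt.comp_hasDerivAt t (hasDerivAt_axisLine c t)
  have h2 : HasDerivAt (fun t : ℝ => (t - (x 0 - c 0)) ^ 2 + distSqToAxis c x)
      (2 * (t - (x 0 - c 0))) t := by
    simpa using (((hasDerivAt_id t).sub_const (x 0 - c 0)).pow 2).add_const (distSqToAxis c x)
  have h3 := h2.sqrt (fun h0 => ht (by rw [dist_axisLine_eq_sqrt, h0, Real.sqrt_zero]))
  rw [mul_div_mul_left _ _ two_ne_zero, ← dist_axisLine_eq_sqrt] at h3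
  refine h1.unique (h3.congr_of_eventuallyEq (Eventually.of_forall fun s => ?_))
  exact dist_axisLine_eq_sqrt c x s

/-- The multiplicity along the line, extended by zero outside of the segment. -/
noncomputable def lineMult (δ : ℝ) : ℝ → ℝ := (Ioo 0 δ).indicator ceilDensity

lemma exists_int_lineMult (δ t : ℝ) : ∃ k : ℤ, lineMult δ t = k := by
  by_cases h : t ∈ Ioo 0 δ
  · exact ⟨_, indicator_of_mem h _⟩
  · exact ⟨0, by simp [lineMult, h]⟩

/-- The multiplicity is monotone on the segment, hence has at most countably many jumps. -/
lemma countable_not_continuousAt_lineMult {δ : ℝ} (hδ : δ ≤ Real.exp (-2)) :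
    {t | ¬ ContinuousAt (lineMult δ) t}.Countable := by
  have h1 :=
    (antitoneOn_ceilDensity.mono (Ioo_subset_Ioo_right hδ)).countable_not_continuousWithinAt
  refine (h1.union ((countable_singleton (0 : ℝ)).union (countable_singleton δ))).mono
    fun t ht => ?_
  by_contra hn
  simp only [mem_union, mem_ofPred_eq, mem_singleton_iff, not_or, not_and, not_not] at hn
  obtain ⟨hn1, hn2, hn3⟩ := hn
  refine ht ?_
  by_cases hm : t ∈ Ioo 0 δ
  · have h2 : Ioo 0 δ ∈ 𝓝 t := isOpen_Ioo.mem_nhds hm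
    exact ((hn1 hm).continuousAt h2).congr
      ((eqOn_indicator (f := ceilDensity)).symm.eventuallyEq_of_mem h2)
  · have h2 : (Icc 0 δ)ᶜ ∈ 𝓝 t := isClosed_Icc.isOpen_compl.mem_nhds fun h =>
      hm ⟨lt_of_le_of_ne h.1 (Ne.symm hn2), lt_of_le_of_ne h.2 hn3⟩
    refine (continuousAt_const (y := (0 : ℝ))).congr ?_
    filter_upwards [h2] with s hs
    exact (indicator_of_notMem (fun h => hs (Ioo_subset_Icc_self h)) _).symm

/-- The integrand of the slices along the line. -/
noncomputable def sliceIntegrand (c : E3) (δ : ℝ) (x : E3) (ψ : E3 → ℝ) (t : ℝ) : ℝ :=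
  lineMult δ t * (ψ (axisLine c t) * ((t - (x 0 - c 0)) / dist (axisLine c t) x))

lemma integrable_sliceIntegrand (c : E3) {δ : ℝ} (hδ : δ ≤ Real.exp (-2)) (x : E3) {ψ : E3 → ℝ}
    (hψ : Continuous ψ) : Integrable (sliceIntegrand c δ x ψ) := by
  have hγ := (isometry_axisLine c).continuous
  obtain ⟨C, hC⟩ := (isCompact_Icc (a := (0 : ℝ)) (b := δ)).exists_bound_of_continuousOn
    (hψ.comp hγ).continuousOn
  have hint : IntegrableOn (fun t => ceilDensity t *
      (ψ (axisLine c t) * ((t - (x 0 - c 0)) / dist (axisLine c t) x))) (Ioo 0 δ) := by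
    refine (integrableOn_ceilDensity hδ).mul_bdd (c := C) ?_ ?_
    · have h1 : Measurable fun t => ψ (axisLine c t) := (hψ.comp hγ).measurable
      have h2 : Measurable fun t => dist (axisLine c t) x := (hγ.dist continuous_const).measurable
      exact (h1.mul ((measurable_id.sub_const _).div h2)).aestronglyMeasurable
    · filter_upwards [ae_restrict_mem measurableSet_Ioo] with t ht
      have h1 := hC t (Ioo_subset_Icc_self ht)
      have h2 : ‖(t - (x 0 - c 0)) / dist (axisLine c t) x‖ ≤ 1 := by
        rw [norm_div, Real.norm_of_nonneg dist_nonneg]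
        refine div_le_one_of_le₀ ?_ dist_nonneg
        rw [dist_axisLine_eq_sqrt, Real.norm_eq_abs]
        exact Real.abs_le_sqrt (le_add_of_nonneg_right (distSqToAxis_nonneg c x))
      rw [norm_mul]
      exact (mul_le_of_le_one_right (norm_nonneg _) h2).trans h1
  convert! hint.integrable_indicator measurableSet_Ioo using 1
  ext t
  by_cases h : t ∈ Ioo 0 δ <;> simp [sliceIntegrand, lineMult, h]

/-- A shell with `ρ < r` avoids its centre `x`, where the distance is not differentiable, so that
`du` applied to `e₀` is `(t - a) / u` on the whole shell. -/
lemma segmentCurrent_eval_shell (c : E3) {δ : ℝ} (hδ : δ ≤ Real.exp (-2)) (x : E3) (ψ : E3 → ℝ)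
    {r ρ : ℝ} (hρ : ρ < r) :
    (segmentCurrent c δ hδ).eval ({y : E3 | |dist y x - r| ≤ ρ}.indicator
        (fun y => ψ y • fderiv ℝ (fun z : E3 => dist z x) y)) =
      ∫ t in {t : ℝ | |√((t - (x 0 - c 0)) ^ 2 + distSqToAxis c x) - r| ≤ ρ},
        sliceIntegrand c δ x ψ t := by
  have hms : MeasurableSet {t : ℝ | |√((t - (x 0 - c 0)) ^ 2 + distSqToAxis c x) - r| ≤ ρ} :=
    measurableSet_le (by fun_prop) measurable_const
  rw [segmentCurrent_eval, ← integral_indicator measurableSet_Ioo, ← integral_indicator hms]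
  congr 1
  ext t
  by_cases h : t ∈ Ioo 0 δ
  · by_cases h' : |dist (axisLine c t) x - r| ≤ ρ
    · have hne : dist (axisLine c t) x ≠ 0 := fun h0 => by
        rw [h0, abs_le] at h'; linarith
      have h'' := h'
      rw [dist_axisLine_eq_sqrt] at h''
      rw [indicator_of_mem h, indicator_of_mem (a := t) h'',
        indicator_of_mem (a := axisLine c t) h']
      simp [sliceIntegrand, lineMult, h, fderiv_dist_axisLine c x hne]
    · have h'' := h'
      rw [dist_axisLine_eq_sqrt] at h''
      rw [indicator_of_mem h, indicator_of_notMem (a := t) h'',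
        indicator_of_notMem (a := axisLine c t) h']
      simp
  · rw [indicator_of_notMem h]
    refine (indicator_apply_eq_zero.2 fun _ => ?_).symm
    simp [sliceIntegrand, lineMult, h]

/-- A sphere that is not tangent to the line and does not meet it in a jump of the multiplicity
has a slice, which consists of at most two points with integer multiplicities. -/
lemma segmentCurrent_hasSphereSlice (c : E3) {δ : ℝ} (hδ : δ ≤ Real.exp (-2)) (x : E3) :
    ∃ N : Set ℝ, N.Countable ∧ ∀ r : ℝ, 0 < r → r ∉ N → ∃ S : (E3 → ℝ) → ℝ,
      (segmentCurrent c δ hδ).HasSphereSlice x r S ∧ ∃ k : ℤ, S (fun _ => 1) = k := by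
  set a := x 0 - c 0 with ha
  set h := distSqToAxis c x with hh
  refine ⟨{√h} ∪ (fun t => dist (axisLine c t) x) '' {t | ¬ ContinuousAt (lineMult δ) t},
    (countable_singleton _).union ((countable_not_continuousAt_lineMult hδ).image _),
    fun r hr0 hrN => ?_⟩
  have hev : ∀ᶠ ρ : ℝ in 𝓝[>] 0, ρ < r := nhdsWithin_le_nhds (eventually_lt_nhds hr0)
  rw [mem_union, not_or, mem_singleton_iff] at hrN
  obtain ⟨hr1, hr2⟩ := hrN
  rcases lt_or_gt_of_ne hr1 with hlt | hgt
  · -- The sphere does not reach the line.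
    refine ⟨fun _ => 0, fun ψ hψ => ?_, 0, by simp⟩
    refine tendsto_const_nhds.congr' ?_
    have hev2 : ∀ᶠ ρ : ℝ in 𝓝[>] 0, ρ < √h - r :=
      nhdsWithin_le_nhds (eventually_lt_nhds (sub_pos.2 hlt))
    filter_upwards [hev, hev2] with ρ hρ hρ2
    rw [segmentCurrent_eval_shell c hδ x ψ hρ]
    have hempty : {t : ℝ | |√((t - a) ^ 2 + h) - r| ≤ ρ} = ∅ := by
      refine eq_empty_of_forall_notMem fun t ht => ?_
      have h1 := (abs_le.1 (show |√((t - a) ^ 2 + h) - r| ≤ ρ from ht)).2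
      have h2 : √h ≤ √((t - a) ^ 2 + h) :=
        Real.sqrt_le_sqrt (le_add_of_nonneg_left (sq_nonneg _))
      linarith
    rw [hempty]
    simp
  · -- The sphere crosses the line transversally at the parameters `a + s` and `a - s`.
    have hlt : h < r ^ 2 := (Real.sqrt_lt' hr0).1 hgt
    set s := √(r ^ 2 - h) with hs
    have hs0 : 0 < s := Real.sqrt_pos.2 (sub_pos.2 hlt)
    have hs2 : s ^ 2 = r ^ 2 - h := Real.sq_sqrt (sub_pos.2 hlt).le
    have hdist : ∀ t, (t - a) ^ 2 = s ^ 2 → dist (axisLine c t) x = r := fun t ht => by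
      rw [dist_axisLine_eq_sqrt, ← ha, ← hh, ht, hs2, sub_add_cancel, Real.sqrt_sq hr0.le]
    have hcont : ∀ t, (t - a) ^ 2 = s ^ 2 → ∀ ψ : E3 → ℝ, Continuous ψ →
        ContinuousAt (sliceIntegrand c δ x ψ) t := fun t ht ψ hψ => by
      have hγ := (isometry_axisLine c).continuous
      have h1 : ContinuousAt (lineMult δ) t := by
        by_contra hn
        exact hr2 ⟨t, hn, hdist t ht⟩
      refine h1.mul ((hψ.comp hγ).continuousAt.mul (ContinuousAt.div ?_ ?_ ?_))
      · fun_prop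
      · exact (hγ.dist continuous_const).continuousAt
      · rw [hdist t ht]; exact hr0.ne'
    have hplus : (a + s - a) ^ 2 = s ^ 2 := by ring
    have hminus : (a - s - a) ^ 2 = s ^ 2 := by ring
    refine ⟨fun ψ => lineMult δ (a + s) * ψ (axisLine c (a + s)) -
      lineMult δ (a - s) * ψ (axisLine c (a - s)), fun ψ hψ => ?_, ?_⟩
    · have hlim := tendsto_shell_average (integrable_sliceIntegrand c hδ x hψ.continuous) hr0
        hlt (hcont _ hplus ψ hψ.continuous) (hcont _ hminus ψ hψ.continuous)
      have hval : sliceIntegrand c δ x ψ (a + s) * (r / s) +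
          sliceIntegrand c δ x ψ (a - s) * (r / s) =
          lineMult δ (a + s) * ψ (axisLine c (a + s)) -
            lineMult δ (a - s) * ψ (axisLine c (a - s)) := by
        unfold sliceIntegrand
        rw [hdist _ hplus, hdist _ hminus, ← ha]
        have := hs0.ne'
        have := hr0.ne'
        field_simp
        ring
      rw [← hs, hval] at hlim
      refine hlim.congr' ?_
      filter_upwards [hev] with ρ hρ
      rw [segmentCurrent_eval_shell c hδ x ψ hρ]
    · obtain ⟨k, hk⟩ := exists_int_lineMult δ (a + s)
      obtain ⟨l, hl⟩ := exists_int_lineMult δ (a - s)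
      exact ⟨k - l, by simp [hk, hl]⟩

/-! ### Test functions concentrated at the end of the segment -/

/-- A smooth radially decreasing function on `E3` with value `1` at `0`, supported in the unit
ball. -/
noncomputable def radialBump (z : E3) : ℝ := Real.smoothTransition (1 - ‖z‖ ^ 2)

lemma contDiff_radialBump : ContDiff ℝ ∞ radialBump :=
  Real.smoothTransition.contDiff.comp (contDiff_const.sub (contDiff_norm_sq ℝ))

lemma tsupport_radialBump_subset : tsupport radialBump ⊆ Metric.closedBall 0 1 := by
  refine closure_minimal (fun z hz => ?_) Metric.isClosed_closedBall
  rw [mem_closedBall_zero_iff]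
  by_contra! h
  exact hz (Real.smoothTransition.zero_of_nonpos (by nlinarith))

lemma exists_norm_fderiv_radialBump_le : ∃ C : ℝ, ∀ z, ‖fderiv ℝ radialBump z‖ ≤ C := by
  have hc : HasCompactSupport radialBump :=
    (isCompact_closedBall 0 1).of_isClosed_subset (isClosed_tsupport _) tsupport_radialBump_subset
  exact (hc.fderiv ℝ).exists_bound_of_continuous
    (contDiff_radialBump.continuous_fderiv (by simp))

/-- The radial bump function rescaled to the ball of centre `c` and radius `ε`. -/
noncomputable def scaledBump (c : E3) (ε : ℝ) (y : E3) : ℝ := radialBump (ε⁻¹ • (y - c))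

lemma contDiff_scaledBump (c : E3) (ε : ℝ) : ContDiff ℝ ∞ (scaledBump c ε) :=
  contDiff_radialBump.comp ((contDiff_id.sub contDiff_const).const_smul _)

lemma tsupport_scaledBump_subset (c : E3) {ε : ℝ} (hε : 0 < ε) :
    tsupport (scaledBump c ε) ⊆ Metric.closedBall c ε := by
  refine closure_minimal (fun y hy => ?_) Metric.isClosed_closedBall
  have h := tsupport_radialBump_subset (subset_tsupport _ hy)
  rw [mem_closedBall_zero_iff, norm_smul, norm_inv, Real.norm_of_nonneg hε.le,
    inv_mul_le_iff₀ hε, mul_one] at h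
  rwa [Metric.mem_closedBall, dist_eq_norm]

lemma norm_fderiv_scaledBump_le {C : ℝ} (hC : ∀ z, ‖fderiv ℝ radialBump z‖ ≤ C) (c : E3) {ε : ℝ}
    (hε : 0 < ε) (y : E3) : ‖fderiv ℝ (scaledBump c ε) y‖ ≤ C / ε := by
  have h1 : HasFDerivAt (fun y : E3 => ε⁻¹ • (y - c)) (ε⁻¹ • ContinuousLinearMap.id ℝ E3) y :=
    ((hasFDerivAt_id y).sub_const c).const_smul ε⁻¹
  have h2 := ((contDiff_radialBump.differentiable (by simp)) (ε⁻¹ • (y - c))).hasFDerivAt.comp y h1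
  have h3 : fderiv ℝ (scaledBump c ε) y = ε⁻¹ • fderiv ℝ radialBump (ε⁻¹ • (y - c)) := by
    refine h2.fderiv.trans ?_
    ext v
    simp
  rw [h3, norm_smul, norm_inv, Real.norm_of_nonneg hε.le, div_eq_inv_mul]
  exact mul_le_mul_of_nonneg_left (hC _) (by positivity)

lemma scaledBump_axisLine (c : E3) (ε t : ℝ) :
    scaledBump c ε (axisLine c t) = Real.smoothTransition (1 - (ε⁻¹ * t) ^ 2) := by
  simp [scaledBump, radialBump, axisLine, norm_smul, mul_pow]

/-- The boundary of the segment current, tested with the bump at scale `ε`, is at least the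
density at `ε`, because the multiplicity is larger than that all along `(0, ε)`. -/
lemma logDensity_le_neg_boundary (c : E3) {δ ε : ℝ} (hδ : δ ≤ Real.exp (-2)) (hε : ε ∈ Ioo 0 δ) :
    logDensity ε ≤ -(segmentCurrent c δ hδ).boundary (scaledBump c ε) := by
  set φ := scaledBump c ε with hφ
  set β : ℝ → ℝ := fun t => φ (axisLine c t) with hβ
  have hβd : ∀ t, HasDerivAt β (fderiv ℝ φ (axisLine c t) (e 0)) t := fun t =>
    (((contDiff_scaledBump c ε).differentiable (by simp)) _).hasFDerivAt.comp_hasDerivAt t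
      (hasDerivAt_axisLine c t)
  set β' : ℝ → ℝ := fun t => fderiv ℝ φ (axisLine c t) (e 0) with hβ'
  have hβ'c : Continuous β' :=
    (((contDiff_scaledBump c ε).continuous_fderiv (by simp)).comp
      (isometry_axisLine c).continuous).clm_apply continuous_const
  have hanti : AntitoneOn β (Ici 0) := by
    intro s hs t ht hst
    simp only [hβ, hφ, scaledBump_axisLine]
    apply Real.smoothTransition.monotone
    have h1 : ε⁻¹ * s ≤ ε⁻¹ * t := mul_le_mul_of_nonneg_left hst (inv_nonneg.2 hε.1.le)
    have h2 : 0 ≤ ε⁻¹ * s := mul_nonneg (inv_nonneg.2 hε.1.le) hs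
    nlinarith
  have hβ'neg : ∀ t, 0 < t → β' t ≤ 0 := fun t ht => by
    rw [show β' t = deriv β t from (hβd t).deriv.symm]
    have := hanti.derivWithin_nonpos (x := t)
    rwa [derivWithin_of_mem_nhds (Ici_mem_nhds ht)] at this
  obtain ⟨C, hC⟩ := exists_norm_fderiv_radialBump_le
  have hint : IntegrableOn (fun t => ceilDensity t * -β' t) (Ioo 0 δ) := by
    refine (integrableOn_ceilDensity hδ).mul_bdd (c := C / ε)
      hβ'c.neg.aestronglyMeasurable (Eventually.of_forall fun t => ?_)
    rw [norm_neg]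
    refine ((fderiv ℝ φ (axisLine c t)).le_opNorm _).trans ?_
    rw [norm_e, mul_one]
    exact norm_fderiv_scaledBump_le hC c hε.1 _
  have hlt1 : δ < 1 := hδ.trans_lt (by simp)
  have hpos : ∀ t ∈ Ioo 0 δ, 0 ≤ ceilDensity t * -β' t := fun t ht =>
    mul_nonneg (ceilDensity_nonneg ht.1 (ht.2.trans hlt1)) (neg_nonneg.2 (hβ'neg t ht.1))
  have hsub : Ioo 0 ε ⊆ Ioo 0 δ := Ioo_subset_Ioo_right hε.2.le
  have hftc : ∫ t in Ioo 0 ε, -β' t = 1 := by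
    rw [← integral_Ioc_eq_integral_Ioo, ← intervalIntegral.integral_of_le hε.1.le,
      intervalIntegral.integral_neg,
      intervalIntegral.integral_eq_sub_of_hasDerivAt (fun t _ => hβd t)
        (hβ'c.intervalIntegrable _ _)]
    simp only [hβ, hφ, scaledBump_axisLine]
    rw [inv_mul_cancel₀ hε.1.ne']
    simp
  rw [RectifiableCurrent.boundary, segmentCurrent_eval, ← integral_neg]
  calc logDensity ε = ∫ t in Ioo 0 ε, logDensity ε * -β' t := by
        rw [integral_const_mul, hftc, mul_one]
    _ ≤ ∫ t in Ioo 0 ε, ceilDensity t * -β' t := by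
        refine setIntegral_mono_on ?_ (hint.mono_set hsub) measurableSet_Ioo fun t ht => ?_
        · exact ((hβ'c.neg.const_mul _).integrableOn_Icc (a := 0) (b := ε)).mono_set
            Ioo_subset_Icc_self
        · refine mul_le_mul_of_nonneg_right ?_ (neg_nonneg.2 (hβ'neg t ht.1))
          exact (antitoneOn_logDensity ⟨ht.1, ht.2.trans (hε.2.trans_le hδ)⟩
            ⟨hε.1, hε.2.trans_le hδ⟩ ht.2.le).trans (Int.le_ceil _)
    _ ≤ ∫ t in Ioo 0 δ, ceilDensity t * -β' t :=
        setIntegral_mono_set hint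
          ((ae_restrict_mem measurableSet_Ioo).mono hpos) hsub.eventuallyLE
    _ = _ := by simp only [mul_neg]; rfl

/-! ### The Hölder estimate for `L^p` forms -/

lemma abs_wedgeCoeff_le (α : Covector) (F : TwoCovector) : |wedgeCoeff α F| ≤ 3 * (‖α‖ * ‖F‖) := by
  have h1 : ∀ i, |α (e i)| ≤ ‖α‖ := fun i => by
    simpa [norm_e] using α.le_opNorm (e i)
  have h2 : ∀ i j, |F ![e i, e j]| ≤ ‖F‖ := fun i j => by
    simpa [norm_e, Fin.prod_univ_two] using F.le_opNorm ![e i, e j]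
  have h3 : ∀ i j k, |α (e i) * F ![e j, e k]| ≤ ‖α‖ * ‖F‖ := fun i j k => by
    rw [abs_mul]
    exact mul_le_mul (h1 i) (h2 j k) (abs_nonneg _) (norm_nonneg _)
  have ha := abs_le.1 (h3 0 1 2)
  have hb := abs_le.1 (h3 1 0 2)
  have hc := abs_le.1 (h3 2 0 1)
  unfold wedgeCoeff
  rw [abs_le]
  constructor <;> linarith [ha.1, ha.2, hb.1, hb.2, hc.1, hc.2]

/-- For `p = ∞` this holds since `∞.toReal = 0` and `1 / 0 = 0`, the right value of `1 / p`. -/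
lemma one_div_toReal_lt_one {p : ℝ≥0∞} (hp : 1 < p) : 1 / p.toReal < 1 := by
  rcases eq_or_ne p ⊤ with rfl | h
  · simp
  · have : 1 < p.toReal := by
      rw [← ENNReal.toReal_one]
      exact (ENNReal.toReal_lt_toReal (by simp) h).2 hp
    exact (div_lt_one (by linarith)).2 this

/-- By Hölder's inequality, the `L¹` norm of an `L^p` form on a ball of radius `ε` is
`O(ε ^ (3 - 3 / p))`. -/
lemma exists_integral_closedBall_norm_le {p : ℝ≥0∞} (hp : 1 < p) {Ω : Set E3}
    {F : E3 → TwoCovector} (hF : MemLp F p (volume.restrict Ω)) (c : E3) :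
    ∃ C : ℝ, ∀ ε : ℝ, 0 < ε → Metric.closedBall c ε ⊆ Ω →
      IntegrableOn F (Metric.closedBall c ε) ∧
      ∫ x in Metric.closedBall c ε, ‖F x‖ ≤ C * ε ^ (3 * (1 - 1 / p.toReal)) := by
  set a : ℝ := 1 - 1 / p.toReal with ha
  have ha0 : 0 ≤ a := (sub_pos.2 (one_div_toReal_lt_one hp)).le
  set N := eLpNorm F p (volume.restrict Ω)
  set V := volume (Metric.ball (0 : E3) 1)
  refine ⟨(N * V ^ a).toReal, fun ε hε hsub => ?_⟩
  set μ := (volume : Measure E3).restrict (Metric.closedBall c ε)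
  have hμ : μ ≤ volume.restrict Ω := Measure.restrict_mono hsub le_rfl
  have hFμ : MemLp F p μ := hF.mono_measure hμ
  have : IsFiniteMeasure μ := ⟨by
    simpa only [μ, Measure.restrict_apply_univ] using
      measure_closedBall_lt_top (μ := (volume : Measure E3)) (x := c) (r := ε)⟩
  have hi : Integrable F μ := hFμ.integrable hp.le
  refine ⟨hi, ?_⟩
  have hNtop : N ≠ ⊤ := hF.2.ne
  have hVtop : V ≠ ⊤ := measure_ball_lt_top.ne
  have h1 : eLpNorm F 1 μ ≤ N * V ^ a * ENNReal.ofReal (ε ^ (3 * a)) := by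
    have h := eLpNorm_le_eLpNorm_mul_rpow_measure_univ hp.le hFμ.1
    have hu : μ univ = ENNReal.ofReal (ε ^ 3) * V := by
      simp only [μ, Measure.restrict_apply_univ]
      rw [Measure.addHaar_closedBall _ _ hε.le, finrank_euclideanSpace, Fintype.card_fin]
    have he : (1 : ℝ) / (1 : ℝ≥0∞).toReal - 1 / p.toReal = a := by simp [ha]
    rw [he, hu, ENNReal.mul_rpow_of_nonneg _ _ ha0,
      ENNReal.ofReal_rpow_of_nonneg (by positivity) ha0, ← Real.rpow_natCast,
      ← Real.rpow_mul hε.le] at h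
    refine h.trans ?_
    rw [mul_comm (ENNReal.ofReal _), ← mul_assoc]
    push_cast
    gcongr
    exact eLpNorm_mono_measure F hμ
  rw [integral_norm_eq_lintegral_enorm hi.1, ← eLpNorm_one_eq_lintegral_enorm]
  have h2 := ENNReal.toReal_mono (by
    refine ENNReal.mul_ne_top (ENNReal.mul_ne_top hNtop ?_) ENNReal.ofReal_ne_top
    exact ENNReal.rpow_ne_top_of_nonneg ha0 hVtop) h1
  rwa [ENNReal.toReal_mul, ENNReal.toReal_ofReal (by positivity)] at h2

/-- The boundary of the segment current is not the exterior derivative of an `L^p` form,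
`p > 1`: the test functions `scaledBump c ε` violate Hölder's inequality as `ε → 0`. -/
theorem not_boundaryEq_segmentCurrent {c : E3} {δ : ℝ} (hδ0 : 0 < δ) (hδ : δ ≤ Real.exp (-2))
    {Ω : Set E3} (hΩ : MeasurableSet Ω) (hsub : Metric.closedBall c δ ⊆ Ω) {p : ℝ≥0∞} (hp : 1 < p)
    {F : E3 → TwoCovector} (hF : MemLp F p (volume.restrict Ω)) :
    ¬ BoundaryEq Ω (segmentCurrent c δ hδ) F := by
  intro hJ
  obtain ⟨A, hA⟩ := exists_integral_closedBall_norm_le hp hF c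
  obtain ⟨C, hC⟩ := exists_norm_fderiv_radialBump_le
  have hC0 : 0 ≤ C := (norm_nonneg _).trans (hC 0)
  have hα : 0 < 3 * (1 - 1 / p.toReal) :=
    mul_pos three_pos (sub_pos.2 (one_div_toReal_lt_one hp))
  refine not_logDensity_le_rpow (C := 3 * C * A) hδ0 hα fun ε hε => ?_
  have hball : Metric.closedBall c ε ⊆ Ω :=
    (Metric.closedBall_subset_closedBall hε.2.le).trans hsub
  obtain ⟨hi, hA⟩ := hA ε hε.1 hball
  have hts := tsupport_scaledBump_subset c hε.1
  have hcs : HasCompactSupport (scaledBump c ε) :=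
    (isCompact_closedBall c ε).of_isClosed_subset (isClosed_tsupport _) hts
  have hb := hJ _ (contDiff_scaledBump c ε) hcs (hts.trans hball)
  have hlow := logDensity_le_neg_boundary c hδ hε
  have hup : |∫ x in Ω, wedgeCoeff (fderiv ℝ (scaledBump c ε) x) (F x)| ≤
      ∫ x in Metric.closedBall c ε, 3 * (C / ε) * ‖F x‖ := by
    rw [setIntegral_eq_of_subset_of_forall_sdiff_eq_zero hΩ hball fun x hx => ?_]
    · rw [← Real.norm_eq_abs]
      refine norm_integral_le_of_norm_le (hi.norm.const_mul _) (Eventually.of_forall fun x => ?_)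
      refine (abs_wedgeCoeff_le _ _).trans ?_
      rw [mul_assoc]
      gcongr
      exact norm_fderiv_scaledBump_le hC c hε.1 x
    · have h0 : fderiv ℝ (scaledBump c ε) x = 0 :=
        image_eq_zero_of_notMem_tsupport fun h => hx.2 (hts (tsupport_fderiv_subset ℝ h))
      simp [wedgeCoeff, h0]
  rw [integral_const_mul] at hup
  have h1 : logDensity ε ≤ 3 * (C / ε) * (A * ε ^ (3 * (1 - 1 / p.toReal))) := by
    refine hlow.trans ((neg_le_abs _).trans ?_)
    rw [hb]
    refine hup.trans ?_
    have := hε.1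
    gcongr
  calc ε * logDensity ε ≤ ε * (3 * (C / ε) * (A * ε ^ (3 * (1 - 1 / p.toReal)))) :=
        mul_le_mul_of_nonneg_left h1 hε.1.le
    _ = _ := by
      have := hε.1.ne'
      field_simp

end IntegerFlux

theorem mainTheorem11 (Ω : Set IntegerFlux.E3) (hΩ : IsOpen Ω) (hne : Ω.Nonempty) :
    ∃ J : IntegerFlux.RectifiableCurrent,
      J.CompactlySupportedIn Ω ∧ J.mass < ⊤ ∧
      (∀ x : IntegerFlux.E3, ∃ N : Set ℝ, N.Countable ∧
        ∀ r : ℝ, 0 < r → r ∉ N →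
          ∃ S : (IntegerFlux.E3 → ℝ) → ℝ,
            J.HasSphereSlice x r S ∧ ∃ k : ℤ, S (fun _ => 1) = k) ∧
      ∀ p : ENNReal, 1 < p → ∀ F : IntegerFlux.E3 → IntegerFlux.TwoCovector,
        IntegerFlux.IntegerFluxClass p Ω F → ¬ IntegerFlux.BoundaryEq Ω J F := by
  obtain ⟨c, hc⟩ := hne
  obtain ⟨R, hR, hball⟩ := Metric.isOpen_iff.1 hΩ c hc
  -- `g` is decreasing only on `(0, exp (-2))`
  set δ := min (R / 2) (Real.exp (-2))
  have hδ0 : 0 < δ := lt_min (half_pos hR) (Real.exp_pos _)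
  have hδ : δ ≤ Real.exp (-2) := min_le_right _ _
  have hsub : Metric.closedBall c δ ⊆ Ω :=
    (Metric.closedBall_subset_ball ((min_le_left _ _).trans_lt (half_lt_self hR))).trans hball
  exact ⟨IntegerFlux.segmentCurrent c δ hδ,
    IntegerFlux.segmentCurrent_compactlySupportedIn hδ hsub,
    IntegerFlux.segmentCurrent_mass_lt_top c hδ,
    IntegerFlux.segmentCurrent_hasSphereSlice c hδ,
    fun p hp F hF => IntegerFlux.not_boundaryEq_segmentCurrent hδ0 hδ hΩ.measurableSet hsub hp
      hF.1⟩
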